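/- Let $d\in\mathbb N$ and let $g:\mathbb R^d\to\mathbb R$ satisfy: 1. $g$ is continuously differentiable and non-negative; 2. $\nabla g$ is Lipschitz continuous: there is $L\ge 0$ with $\|\nabla g(\theta)-\nabla g(\theta')\|\le L\|\theta-\theta'\|$ for all $\theta,\theta'\in\mathbb R^d$; 3. $g$ is not asymptotically flat: there is $\eta>0$ with $\liminf_{\|\theta\|\to+\infty}\|\nabla g(\theta)\|^2>\eta$ (the value $+\infty$ is allowed); 4. $g$ is coercive: $\lim_{\|\theta\|\to+\infty}g(\theta)=+\infty$. Let $(\xi_n)_{n\ge1}$ be independent random variables on a probability space $(\Omega,\mathscr F,\mathbb P)$ with values in a measurable space $\Xi$, let $\theta_1$ be an $\mathbb R^d$-valued random vector (for instance a deterministic point), let $(\theta,\xi)\mapsto\nabla g(\theta,\xi)$ be a measurable map $\mathbb R^d\times\Xi\to\mathbb R^d$ (the stochastic gradient), and let $\alpha_0>0$ and $S_0>0$ be constants. Let $(\theta_n)_{n\ge1}$ be generated by AdaGrad-Norm, that is, for all $n\ge1$, $$S_n=S_{n-1}+\|\nabla g(\theta_n,\xi_n)\|^2,\qquad \theta_{n+1}=\theta_n-\frac{\alpha_0}{\sqrt{S_n}}\,\nabla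 g(\theta_n,\xi_n).$$ Put $\mathscr F_0=\{\emptyset,\Omega\}$ and $\mathscr F_n=\sigma(\theta_1,\xi_1,\dots,\xi_n)$ for $n\ge1$. Suppose that the stochastic gradients $\nabla g(\theta_n,\xi_n)$ are square integrable and that there are constants $\sigma_0,\sigma_1\ge0$ and $D_0,D_1>0$ such that for every $n\ge1$, almost surely, - $\mathbb E[\nabla g(\theta_n,\xi_n)\mid\mathscr F_{n-1}]=\nabla g(\theta_n)$; - $\mathbb E[\|\nabla g(\theta_n,\xi_n)\|^2\mid\mathscr F_{n-1}]\le\sigma_0\|\nabla g(\theta_n)\|^2+\sigma_1$; - if $\|\nabla g(\theta_n)\|^2<D_0$, then $\|\nabla g(\theta_n,\xi_n)\|^2<D_1$. Then $$\sup_{n\ge1}\|\theta_n\|<+\infty\quad\text{almost surely.}$$ -/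

import Mathlib

open MeasureTheory ProbabilityTheory Filter
open scoped NNReal ENNReal Gradient

/-- Standing assumptions on the objective function `g : ℝᵈ → ℝ`. -/
structure ObjectiveAssumptions {d : ℕ} (g : EuclideanSpace ℝ (Fin d) → ℝ) : Prop where
  contDiff : ContDiff ℝ 1 g
  nonneg : ∀ x, 0 ≤ g x
  lipschitz_gradient : ∃ L : ℝ≥0, LipschitzWith L (∇ g)
  /-- `g` is not asymptotically flat. The lower limit is taken in `[-∞, ∞]`, as it may be `+∞`. -/
  not_asymptotically_flat : ∃ η : ℝ, 0 < η ∧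
    (η : EReal) < liminf (fun x => ((‖∇ g x‖ ^ 2 : ℝ) : EReal))
      (Bornology.cobounded (EuclideanSpace ℝ (Fin d)))

/-- `g x → +∞` as `‖x‖ → +∞`. -/
def IsCoerciveFunction {d : ℕ} (g : EuclideanSpace ℝ (Fin d) → ℝ) : Prop :=
  Tendsto g (Bornology.cobounded (EuclideanSpace ℝ (Fin d))) atTop

/-- `(θ, S)` is generated by AdaGrad-Norm with stochastic gradient oracle `G` (where `G x z` stands
for `∇g(x, z)`), noise `ξ` and constants `α₀`, `S₀`. The iterates are `θ 1, θ 2, …`, driven by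
the noise variables `ξ 1, ξ 2, …`; the values `θ 0` and `ξ 0` play no role. -/
structure IsAdaGradNorm {Ω Ξ : Type*} {d : ℕ}
    (G : EuclideanSpace ℝ (Fin d) → Ξ → EuclideanSpace ℝ (Fin d)) (ξ : ℕ → Ω → Ξ)
    (α₀ S₀ : ℝ) (θ : ℕ → Ω → EuclideanSpace ℝ (Fin d)) (S : ℕ → Ω → ℝ) : Prop where
  S_zero : ∀ ω, S 0 ω = S₀
  S_succ : ∀ n ω, S (n + 1) ω = S n ω + ‖G (θ (n + 1) ω) (ξ (n + 1) ω)‖ ^ 2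
  θ_succ : ∀ n ω, θ (n + 2) ω =
    θ (n + 1) ω - (α₀ / √(S (n + 1) ω)) • G (θ (n + 1) ω) (ξ (n + 1) ω)

/-- The σ-algebras `ℱ₀ = {∅, Ω}` and `ℱₙ = σ(θ₁, ξ₁, …, ξₙ)` for `n ≥ 1`. -/
@[reducible] def historySigmaAlgebra {Ω Ξ : Type*} [MeasurableSpace Ξ] {d : ℕ}
    (θ₁ : Ω → EuclideanSpace ℝ (Fin d)) (ξ : ℕ → Ω → Ξ) : ℕ → MeasurableSpace Ω
  | 0 => ⊥
  | n + 1 => MeasurableSpace.comap θ₁ inferInstance ⊔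
      ⨆ i ∈ Set.Icc 1 (n + 1), MeasurableSpace.comap (ξ i) inferInstance

/-- Standing assumptions on the stochastic gradients `G (θ n) (ξ n)`, `n ≥ 1`. -/
structure OracleAssumptions {Ω Ξ : Type*} [MeasurableSpace Ω] [MeasurableSpace Ξ] {d : ℕ}
    (μ : Measure Ω) (g : EuclideanSpace ℝ (Fin d) → ℝ)
    (G : EuclideanSpace ℝ (Fin d) → Ξ → EuclideanSpace ℝ (Fin d)) (ξ : ℕ → Ω → Ξ)
    (θ : ℕ → Ω → EuclideanSpace ℝ (Fin d)) : Prop where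
  /-- The conditional expectations below are those of integrable functions. -/
  memLp_two : ∀ n ≥ 1, MemLp (fun ω => G (θ n ω) (ξ n ω)) 2 μ
  unbiased : ∀ n ≥ 1,
    μ[fun ω => G (θ n ω) (ξ n ω) | historySigmaAlgebra (θ 1) ξ (n - 1)]
      =ᵐ[μ] fun ω => ∇ g (θ n ω)
  affine_variance : ∃ σ₀ σ₁ : ℝ, 0 ≤ σ₀ ∧ 0 ≤ σ₁ ∧ ∀ n ≥ 1,
    μ[fun ω => ‖G (θ n ω) (ξ n ω)‖ ^ 2 | historySigmaAlgebra (θ 1) ξ (n - 1)]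
      ≤ᵐ[μ] fun ω => σ₀ * ‖∇ g (θ n ω)‖ ^ 2 + σ₁
  bounded_near_critical : ∃ D₀ D₁ : ℝ, 0 < D₀ ∧ 0 < D₁ ∧ ∀ n ≥ 1, ∀ᵐ ω ∂μ,
    ‖∇ g (θ n ω)‖ ^ 2 < D₀ → ‖G (θ n ω) (ξ n ω)‖ ^ 2 < D₁

/-! By coercivity it is enough to bound `g` along the iterates. Let `x k` be the iterate, `H k` its
stochastic gradient, `T k` the sum of squares before `H k` is added, and `w = ‖∇ g (x k)‖`. Two
estimates are combined.

The first is that `∑ w ^ 2 / T k` has finite expectation, after localization. Dividing the descent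
inequality by `√(T (k + 1))` produces the inner product of `∇ g (x k)` and `H k` over `T (k + 1)`,
which is not predictable. Passing to `T k` costs a Young term with predictable weight and a term
that telescopes once multiples of `w ^ 2 / T` and `1 / T` are added to `g / √T` (`neg_inner_div_le`,
`sq_div_step_le`). The resulting function has conditional drift at most `-(α / 4) * w ^ 2 / T k`
(`adagrad_lyapunov_step`). Its initial value need not be integrable, so the sum is controlled on
sublevel sets of that value, which exhaust `Ω`.

The second concerns `log (1 + g)`. Since `‖∇ g‖` is at most a multiple of `1 + g`, its increment is
at most a martingale difference plus a multiple of `‖H k‖ ^ 2 / T k` (`adagrad_log_step`). Where `g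
> K` the gradient is bounded below, so `σ₀ * w ^ 2 + σ₁` is at most a multiple of `w ^ 2`, and the
first estimate makes both series converge almost surely. Where `g ≤ K`, the next value of `g` is
bounded because no step is longer than `α`. A sequence with such increments and such restarts is
bounded (`exists_forall_le_of_excursions`). -/

/-! ### Deterministic inequalities for a single step -/

section Deterministic

variable {E : Type*} [NormedAddCommGroup E] [InnerProductSpace ℝ E] [CompleteSpace E]

/-- The descent lemma, with the constant `L` in place of `L / 2`. -/
theorem descent_of_lipschitzWith_gradient {g : E → ℝ} (hg : Differentiable ℝ g) {L : ℝ≥0}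
    (hL : LipschitzWith L (∇ g)) (x y : E) :
    g y ≤ g x + inner ℝ (∇ g x) (y - x) + L * ‖y - x‖ ^ 2 := by
  -- With the linear part at `x` removed, the derivative on the segment has norm at most `L * ‖y -
  -- x‖`; the mean value inequality then gives `L` rather than `L / 2`.
  have hder : ∀ z, HasFDerivAt (fun z => g z - inner ℝ (∇ g x) z)
      (InnerProductSpace.toDual ℝ E (∇ g z - ∇ g x)) z := by
    intro z
    have h1 := (hg z).hasGradientAt.hasFDerivAt
    have h2 := (innerSL ℝ (∇ g x)).hasFDerivAt (x := z)
    refine (h1.sub h2).congr_fderiv ?_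
    ext v
    simp
  have h := (convex_segment (𝕜 := ℝ) x y).norm_image_sub_le_of_norm_hasFDerivWithin_le
    (C := L * ‖y - x‖) (fun z _ => (hder z).hasFDerivWithinAt) (fun z hz => ?_)
    (left_mem_segment ℝ x y) (right_mem_segment ℝ x y)
  · have h' := (abs_le.1 h).2
    rw [inner_sub_right]
    nlinarith
  · rw [LinearIsometryEquiv.norm_map]
    have h1 := hL.dist_le_mul z x
    rw [dist_eq_norm, dist_eq_norm] at h1
    refine h1.trans ?_
    gcongr
    obtain ⟨t, ht, rfl⟩ := (segment_eq_image' ℝ x y) ▸ hz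
    simp only [add_sub_cancel_left, norm_smul, Real.norm_eq_abs, abs_of_nonneg ht.1]
    exact mul_le_of_le_one_left (norm_nonneg _) ht.2

/-- A gradient step of length `1 / (2 * L)` lowers `g` by at least `‖∇ g x‖ ^ 2 / (4 * L)`, and `g`
cannot become negative. -/
theorem norm_gradient_sq_le {g : E → ℝ} (hg : Differentiable ℝ g) (h0 : ∀ x, 0 ≤ g x) {L : ℝ≥0}
    (hLpos : 0 < L) (hL : LipschitzWith L (∇ g)) (x : E) : ‖∇ g x‖ ^ 2 ≤ 4 * L * g x := by
  have hL' : (0 : ℝ) < L := hLpos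
  have h := descent_of_lipschitzWith_gradient hg hL x (x - (1 / (2 * L : ℝ)) • ∇ g x)
  have h1 := h0 (x - (1 / (2 * L : ℝ)) • ∇ g x)
  have e : x - (1 / (2 * L : ℝ)) • ∇ g x - x = -((1 / (2 * L : ℝ)) • ∇ g x) := by abel
  rw [e, norm_neg, inner_neg_right, inner_smul_right, real_inner_self_eq_norm_sq, norm_smul,
    Real.norm_of_nonneg (by positivity)] at h
  have h2 : (L : ℝ) * (1 / (2 * L) * ‖∇ g x‖) ^ 2 = 1 / (4 * L) * ‖∇ g x‖ ^ 2 := by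
    field_simp; ring
  have h3 : 1 / (2 * (L : ℝ)) * ‖∇ g x‖ ^ 2 = 2 * (1 / (4 * L) * ‖∇ g x‖ ^ 2) := by
    field_simp; ring
  have h4 : 1 / (4 * (L : ℝ)) * ‖∇ g x‖ ^ 2 ≤ g x := by linarith
  have h5 : ‖∇ g x‖ ^ 2 = 4 * L * (1 / (4 * (L : ℝ)) * ‖∇ g x‖ ^ 2) := by field_simp
  rw [h5]
  gcongr

/-- The error made in replacing `p / b` by `p / a`, in Young form with a weight depending only on
`a` and `w`. -/
theorem neg_inner_div_le {a b h w p σ₀ σ₁ : ℝ} (ha : 0 < a) (hab : a ≤ b)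
    (hp : |p| ≤ w * h) (hσ₀ : 0 < σ₀) (hσ₁ : 0 < σ₁) :
    -(p / b) ≤ -(p / a) + w ^ 2 / (a * (σ₀ * w ^ 2 + σ₁)) * h ^ 2 / 2
      + (σ₀ * w ^ 2 + σ₁) * (1 / a - 1 / b) / 2 := by
  obtain ⟨δ, hδ⟩ : ∃ δ, δ = 1 / a - 1 / b := ⟨_, rfl⟩
  obtain ⟨q, hq⟩ : ∃ q, q = σ₀ * w ^ 2 + σ₁ := ⟨_, rfl⟩
  rw [← hδ, ← hq]
  have hδ0 : 0 ≤ δ := hδ ▸ sub_nonneg.2 (one_div_le_one_div_of_le ha hab)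
  have hδa : a * δ ≤ 1 := by
    have e : a * δ = 1 - a / b := by rw [hδ]; field_simp
    have := div_nonneg ha.le (ha.le.trans hab)
    linarith
  have hq0 : 0 < q := by rw [hq]; positivity
  have e1 : -(p / b) = -(p / a) + p * δ := by rw [hδ]; ring
  have e2 : p * δ ≤ w * h * δ := by
    gcongr
    exact (le_abs_self p).trans hp
  -- Young's inequality with weight `a * q`. As `a * δ ≤ 1`, one of the two factors `δ` can be
  -- dropped, and what is left telescopes.
  have e3 : w ^ 2 / (a * q) * h ^ 2 / 2 + q * (a * δ * δ) / 2 - w * h * δ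
      = (w * h - a * q * δ) ^ 2 / (2 * a * q) := by field_simp; ring
  have e4 : 0 ≤ (w * h - a * q * δ) ^ 2 / (2 * a * q) := by positivity
  have e5 : q * (a * δ * δ) ≤ q * (1 * δ) := by gcongr
  linarith

/-- With `r` and `t` consecutive values of `√T`, this makes the second-order term of the descent
inequality, divided by `√T`, telescope. -/
theorem sq_div_mul_le_of_sq_add {h r t : ℝ} (hr : 0 < r) (hrt : r ≤ t)
    (ht : t ^ 2 = r ^ 2 + h ^ 2) : h ^ 2 / (t ^ 2 * t) ≤ 2 / r - 2 / t := by
  have ht0 : 0 < t := hr.trans_le hrt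
  have e1 : h ^ 2 = t ^ 2 - r ^ 2 := by rw [ht]; ring
  have : 0 ≤ (t - r) * t * (2 * t ^ 2 - r * t - r ^ 2) :=
    mul_nonneg (mul_nonneg (sub_nonneg.2 hrt) ht0.le) (by nlinarith)
  rw [e1, div_sub_div _ _ hr.ne' ht0.ne', div_le_div_iff₀ (by positivity) (by positivity)]
  linarith

theorem add_sq_le_of_pos {x y σ : ℝ} (hσ : 0 < σ) :
    (x + y) ^ 2 ≤ (1 + 1 / (2 * σ)) * x ^ 2 + (1 + 2 * σ) * y ^ 2 := by
  have e : (1 + 1 / (2 * σ)) * x ^ 2 + (1 + 2 * σ) * y ^ 2 - (x + y) ^ 2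
      = (x - 2 * σ * y) ^ 2 / (2 * σ) := by field_simp; ring
  have : 0 ≤ (x - 2 * σ * y) ^ 2 / (2 * σ) := by positivity
  linarith

/-- The growth of `‖∇ g‖ ^ 2 / S` in one step. -/
theorem sq_div_step_le {a b t h w w' α L σ : ℝ} (ha : 0 < a) (hb : b = a + h ^ 2)
    (ht2 : t ^ 2 = b) (hw' : 0 ≤ w') (hσ : 0 < σ)
    (hww' : w' ≤ w + L * (α / t * h)) :
    w' ^ 2 / b ≤ w ^ 2 / b + w ^ 2 / (2 * σ * a)
      + (1 + 2 * σ) * (L * α) ^ 2 * (1 / a - 1 / b) := by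
  have hb0 : 0 < b := by rw [hb]; positivity
  have hab : a ≤ b := by rw [hb]; nlinarith
  have hh2 : h ^ 2 / b / b ≤ 1 / a - 1 / b := by
    have : 1 / a - 1 / b = h ^ 2 / b / a := by
      have : h ^ 2 = b - a := by rw [hb]; ring
      rw [this]; field_simp
    rw [this]
    gcongr
  calc w' ^ 2 / b ≤ (w + L * (α / t * h)) ^ 2 / b := by gcongr
    _ ≤ ((1 + 1 / (2 * σ)) * w ^ 2 + (1 + 2 * σ) * (L * (α / t * h)) ^ 2) / b := by
      gcongr
      exact add_sq_le_of_pos hσ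
    _ = w ^ 2 / b + w ^ 2 / (2 * σ * b) + (1 + 2 * σ) * (L * α) ^ 2 * (h ^ 2 / b / b) := by
      have : (L * (α / t * h)) ^ 2 = (L * α) ^ 2 * (h ^ 2 / b) := by rw [← ht2]; ring
      rw [this]; field_simp
    _ ≤ _ := by gcongr

/-- One step of AdaGrad-Norm decreases `g / √S + (c * ‖∇ g‖ ^ 2 + C) / S + C' / √S`, up to a term
whose conditional expectation is negative. Here `h` and `p` stand for the norm of the stochastic
gradient and its inner product with the gradient. -/
theorem adagrad_lyapunov_step {a h w w' p g₀ g₁ α L σ₀ σ₁ : ℝ} (ha : 0 < a)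
    (hw' : 0 ≤ w') (hp : |p| ≤ w * h) (hg₀ : 0 ≤ g₀) (hα : 0 < α) (hL : 0 ≤ L)
    (hσ₀ : 0 < σ₀) (hσ₁ : 0 < σ₁)
    (hg₁ : g₁ ≤ g₀ - α / √(a + h ^ 2) * p + L * (α / √(a + h ^ 2) * h) ^ 2)
    (hww' : w' ≤ w + L * (α / √(a + h ^ 2) * h)) :
    g₁ / √(a + h ^ 2) + (α * σ₀ / 2 * w' ^ 2
        + (α * σ₁ / 2 + α * σ₀ / 2 * (1 + 2 * σ₀) * (L * α) ^ 2)) / (a + h ^ 2)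
        + 2 * L * α ^ 2 / √(a + h ^ 2) ≤
      g₀ / √a + (α * σ₀ / 2 * w ^ 2
        + (α * σ₁ / 2 + α * σ₀ / 2 * (1 + 2 * σ₀) * (L * α) ^ 2)) / a + 2 * L * α ^ 2 / √a
        + α * (-(p / a) + w ^ 2 / (a * (σ₀ * w ^ 2 + σ₁)) * h ^ 2 / 2 + w ^ 2 / (4 * a)) := by
  obtain ⟨b, hb⟩ : ∃ b, b = a + h ^ 2 := ⟨_, rfl⟩
  have hb0 : 0 < b := by rw [hb]; positivity
  have hab : a ≤ b := by rw [hb]; nlinarith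
  rw [← hb] at hg₁ hww' ⊢
  obtain ⟨r, hr⟩ : ∃ r, r = √a := ⟨_, rfl⟩
  obtain ⟨t, ht⟩ : ∃ t, t = √b := ⟨_, rfl⟩
  have hr0 : 0 < r := hr ▸ Real.sqrt_pos.2 ha
  have ht0 : 0 < t := ht ▸ Real.sqrt_pos.2 hb0
  have hrt : r ≤ t := hr ▸ ht ▸ Real.sqrt_le_sqrt hab
  have hr2 : r ^ 2 = a := hr ▸ Real.sq_sqrt ha.le
  have ht2 : t ^ 2 = b := ht ▸ Real.sq_sqrt hb0.le
  rw [← ht] at hg₁ hww'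
  rw [← hr, ← ht]
  -- The step size already contains `1 / t`; the second factor `1 / t` turns `p / t` into `p / b`.
  have h1 : g₁ / t ≤ g₀ / r - α * (p / b) + L * α ^ 2 * (2 / r - 2 / t) := by
    calc g₁ / t ≤ (g₀ - α / t * p + L * (α / t * h) ^ 2) / t := by gcongr
      _ = g₀ / t - α * (p / b) + L * α ^ 2 * (h ^ 2 / (t ^ 2 * t)) := by
        rw [← ht2]; field_simp
      _ ≤ _ := by
        have := sq_div_mul_le_of_sq_add (h := h) hr0 hrt (by rw [ht2, hr2, hb])
        gcongr
  have h2 := mul_le_mul_of_nonneg_left (sq_div_step_le ha hb ht2 hw' hσ₀ hww')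
    (by positivity : 0 ≤ α * σ₀ / 2)
  have h3 := mul_le_mul_of_nonneg_left (neg_inner_div_le (b := b) ha hab hp hσ₀ hσ₁) hα.le
  -- The parameter `σ₀` in `sq_div_step_le` is chosen so that the growth of `w ^ 2` costs only a
  -- quarter of the drift `α * w ^ 2 / a`.
  have e : α * σ₀ / 2 * (w ^ 2 / (2 * σ₀ * a)) = α * (w ^ 2 / (4 * a)) := by field_simp; ring
  rw [mul_add, mul_add, e] at h2
  generalize w ^ 2 / (4 * a) = x₁ at *
  generalize w ^ 2 / (a * (σ₀ * w ^ 2 + σ₁)) * h ^ 2 / 2 = x₂ at *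
  linear_combination h1 + h2 + h3

/-- One step of AdaGrad-Norm, seen through `log (1 + g)`. -/
theorem adagrad_log_step {a h v p g₀ g₁ α L C : ℝ} (ha : 0 < a) (hh : 0 ≤ h)
    (hp : |p| ≤ v * h) (hv : v ≤ C * (1 + g₀)) (hg₀ : 0 ≤ g₀) (hg₁0 : 0 ≤ g₁)
    (hα : 0 < α) (hL : 0 ≤ L)
    (hg₁ : g₁ ≤ g₀ - α / √(a + h ^ 2) * p + L * (α / √(a + h ^ 2) * h) ^ 2) :
    Real.log (1 + g₁) ≤ Real.log (1 + g₀) - α * (p / ((1 + g₀) * √a))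
      + (α * C + L * α ^ 2) * (h ^ 2 / a) := by
  set b := a + h ^ 2 with hb
  have hb0 : 0 < b := by positivity
  have hab : a ≤ b := by nlinarith
  set r := √a with hr
  set t := √b with ht
  have hr0 : 0 < r := Real.sqrt_pos.2 ha
  have ht0 : 0 < t := Real.sqrt_pos.2 hb0
  have hrt : r ≤ t := Real.sqrt_le_sqrt hab
  have hr2 : r ^ 2 = a := Real.sq_sqrt ha.le
  have ht2 : t ^ 2 = b := Real.sq_sqrt hb0.le
  have hth : t - r ≤ h := by
    by_contra! hcon
    have : r ^ 2 + h ^ 2 = t ^ 2 := by rw [hr2, ht2]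
    nlinarith [mul_nonneg hr0.le hh]
  -- Concavity of the logarithm. Division by `1 + g₀` later absorbs the factor `v ≤ C * (1 + g₀)` in
  -- the error terms.
  have hlog : Real.log (1 + g₁) ≤ Real.log (1 + g₀) + (g₁ - g₀) / (1 + g₀) := by
    have h1 := Real.log_le_sub_one_of_pos (x := (1 + g₁) / (1 + g₀)) (by positivity)
    rw [Real.log_div (by positivity) (by positivity)] at h1
    have : (1 + g₁) / (1 + g₀) - 1 = (g₁ - g₀) / (1 + g₀) := by field_simp; ring
    linarith
  have hΔ : -(p / t) ≤ -(p / r) + v * (h ^ 2 / a) := by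
    have e1 : -(p / t) = -(p / r) + p * (1 / r - 1 / t) := by ring
    have e2 : 1 / r - 1 / t ≤ h / a := by
      rw [div_sub_div _ _ hr0.ne' ht0.ne', one_mul, mul_one, ← hr2]
      exact div_le_div₀ hh hth (by positivity) (by nlinarith)
    have e3 : 0 ≤ 1 / r - 1 / t := sub_nonneg.2 (one_div_le_one_div_of_le hr0 hrt)
    have e4 : p * (1 / r - 1 / t) ≤ (v * h) * (1 / r - 1 / t) := by
      gcongr
      exact (le_abs_self p).trans hp
    have e5 : (v * h) * (1 / r - 1 / t) ≤ (v * h) * (h / a) :=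
      mul_le_mul_of_nonneg_left e2 ((abs_nonneg p).trans hp)
    have e6 : (v * h) * (h / a) = v * (h ^ 2 / a) := by ring
    linarith
  have hsq : (α / t * h) ^ 2 ≤ α ^ 2 * (h ^ 2 / a) := by
    have : (α / t * h) ^ 2 = α ^ 2 * (h ^ 2 / b) := by rw [← ht2]; field_simp
    rw [this]
    gcongr
  have hdiff : g₁ - g₀ ≤ -(α * (p / r)) + (α * v + L * α ^ 2) * (h ^ 2 / a) := by
    have e1 := mul_le_mul_of_nonneg_left hΔ hα.le
    have e2 := mul_le_mul_of_nonneg_left hsq hL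
    have e3 : α / t * p = α * (p / t) := by ring
    rw [e3] at hg₁
    linarith
  have hg : (0 : ℝ) < 1 + g₀ := by linarith
  have hfin : (g₁ - g₀) / (1 + g₀) ≤
      -(α * (p / ((1 + g₀) * r))) + (α * C + L * α ^ 2) * (h ^ 2 / a) := by
    rw [div_le_iff₀ hg]
    refine hdiff.trans ?_
    have e1 : (-(α * (p / ((1 + g₀) * r))) + (α * C + L * α ^ 2) * (h ^ 2 / a)) * (1 + g₀)
        = -(α * (p / r)) + (α * (C * (1 + g₀)) + L * α ^ 2 * (1 + g₀)) * (h ^ 2 / a) := by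
      field_simp
    rw [e1]
    have e2 : 0 ≤ L * α ^ 2 * g₀ := by positivity
    have e3 := mul_le_mul_of_nonneg_left hv hα.le
    have e4 : 0 ≤ h ^ 2 / a := by positivity
    have e5 := mul_le_mul_of_nonneg_right
      (by linarith : α * v + L * α ^ 2 ≤ α * (C * (1 + g₀)) + L * α ^ 2 * (1 + g₀)) e4
    linarith
  linarith

/-- A sequence that starts afresh from a bounded set whenever it leaves it, and whose increments
are otherwise dominated by those of a bounded sequence, is bounded above. -/
theorem exists_forall_le_of_excursions {f u : ℕ → ℝ} {P : ℕ → Prop} {c B : ℝ}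
    (hB : ∀ n, |∑ k ∈ Finset.range n, u k| ≤ B) (hP : ∀ k, P k → f (k + 1) ≤ f k + u k)
    (hnP : ∀ k, ¬ P k → f (k + 1) ≤ c) : ∃ M, ∀ n, f n ≤ M := by
  -- The summand `B` keeps `B + ∑ u` nonnegative, so that the bound survives a restart at `c`.
  have key : ∀ n, f n ≤ max (f 0) c + B + ∑ k ∈ Finset.range n, u k := by
    intro n
    induction n with
    | zero =>
      have := (abs_nonneg _).trans (hB 0)
      simpa using (le_max_left (f 0) c).trans (by linarith)
    | succ n ih =>
      by_cases h : P n
      · rw [Finset.sum_range_succ]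
        linarith [hP n h]
      · linarith [hnP n h, le_max_right (f 0) c, (abs_le.1 (hB (n + 1))).1]
  exact ⟨max (f 0) c + B + B, fun n => by linarith [key n, (abs_le.1 (hB n)).2]⟩

end Deterministic

/-! ### Conditional drift and martingale convergence -/

section Probability

variable {Ω : Type*} {m₀ : MeasurableSpace Ω} {μ : Measure Ω}

theorem ae_summable_of_sum_integral_le {Z : ℕ → Ω → ℝ} {B : ℝ} (h0 : ∀ k, 0 ≤ᵐ[μ] Z k)
    (hint : ∀ k, Integrable (Z k) μ) (hB : ∀ n, ∑ k ∈ Finset.range n, ∫ ω, Z k ω ∂μ ≤ B) :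
    ∀ᵐ ω ∂μ, Summable fun k => Z k ω := by
  have hfin : ∑' k, ∫⁻ ω, ‖Z k ω‖ₑ ∂μ ≠ ∞ := by
    have hsum : Summable fun k => ∫ ω, Z k ω ∂μ :=
      summable_of_sum_range_le (fun k => integral_nonneg_of_ae (h0 k)) hB
    have e : ∀ k, ∫⁻ ω, ‖Z k ω‖ₑ ∂μ = ENNReal.ofReal (∫ ω, Z k ω ∂μ) := by
      intro k
      rw [ofReal_integral_eq_lintegral_ofReal (hint k) (h0 k)]
      refine lintegral_congr_ae ?_
      filter_upwards [h0 k] with ω hω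
      exact Real.enorm_of_nonneg hω
    simp_rw [e]
    exact hsum.tsum_ofReal_ne_top
  rw [← lintegral_tsum fun k => (hint k).1.enorm] at hfin
  filter_upwards [ae_lt_top' (AEMeasurable.tsum fun k => (hint k).1.enorm) hfin]
    with ω hω
  refine Summable.of_norm ?_
  simpa using ENNReal.summable_toReal hω.ne

theorem integrable_inner_of_memLp_two {E : Type*} [NormedAddCommGroup E] [InnerProductSpace ℝ E]
    {f g : Ω → E} (hf : MemLp f 2 μ) (hg : MemLp g 2 μ) :
    Integrable (fun ω => inner ℝ (f ω) (g ω)) μ :=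
  (hf.norm.integrable_mul hg.norm).mono' (hf.1.inner hg.1)
    (ae_of_all _ fun _ => abs_real_inner_le_norm _ _)

/-- If `V` is nonnegative and its increments are dominated by integrable variables with conditional
expectation at most `-D`, then `∑ D` is integrable on each set `{V 0 ≤ K}`. -/
theorem sum_setIntegral_le_of_nonneg_of_condExp_le [IsFiniteMeasure μ] {ℱ : Filtration ℕ m₀}
    {V N D : ℕ → Ω → ℝ}
    (hV : ∀ k ω, 0 ≤ V k ω) (hV0 : Measurable[ℱ 0] (V 0))
    (hstep : ∀ k ω, V (k + 1) ω ≤ V k ω + N k ω) (hN : ∀ k, Integrable (N k) μ)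
    (hD : ∀ k, Integrable (D k) μ) (hND : ∀ k, μ[N k | ℱ k] ≤ᵐ[μ] fun ω => - D k ω)
    {K : ℝ} (hK : 0 ≤ K) (n : ℕ) :
    ∑ k ∈ Finset.range n, ∫ ω in {ω | V 0 ω ≤ K}, D k ω ∂μ ≤ K * μ.real Set.univ := by
  -- `A` lies in every `ℱ k`, so conditional expectations may be integrated over it; no
  -- integrability of `V` is needed.
  set A := {ω | V 0 ω ≤ K}
  have hA : ∀ k, MeasurableSet[ℱ k] A := fun k =>
    ℱ.mono (Nat.zero_le k) _ (hV0 measurableSet_Iic)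
  have h1 : ∀ k, ∫ ω in A, D k ω ∂μ ≤ ∫ ω in A, - N k ω ∂μ := by
    intro k
    rw [integral_neg, ← setIntegral_condExp (ℱ.le k) (hN k) (hA k), ← integral_neg]
    refine setIntegral_mono_ae (hD k).integrableOn integrable_condExp.neg.integrableOn ?_
    filter_upwards [hND k] with ω hω
    simpa using neg_le_neg hω
  have h2 : ∀ n ω, V n ω ≤ V 0 ω + ∑ k ∈ Finset.range n, N k ω := by
    intro n ω
    induction n with
    | zero => simp
    | succ n ih => rw [Finset.sum_range_succ]; linarith [hstep n ω]
  calc ∑ k ∈ Finset.range n, ∫ ω in A, D k ω ∂μ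
      ≤ ∑ k ∈ Finset.range n, ∫ ω in A, - N k ω ∂μ := Finset.sum_le_sum fun k _ => h1 k
    _ = ∫ ω in A, ∑ k ∈ Finset.range n, - N k ω ∂μ :=
      (integral_finsetSum _ fun k _ => (hN k).neg.integrableOn).symm
    _ ≤ ∫ ω in A, K ∂μ := by
      refine setIntegral_mono_on (integrable_finsetSum _ fun k _ => (hN k).neg.integrableOn)
        (integrable_const _) (ℱ.le 0 _ (hA 0)) fun ω hω => ?_
      have h3 : V 0 ω ≤ K := hω
      rw [Finset.sum_neg_distrib]
      linarith [h2 n ω, hV n ω]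
    _ ≤ K * μ.real Set.univ := by
      rw [setIntegral_const, smul_eq_mul, mul_comm]
      exact mul_le_mul_of_nonneg_left (measureReal_mono (Set.subset_univ A)) hK

/-- A series of martingale differences with summable variances converges almost surely. -/
theorem ae_exists_tendsto_sum_of_condExp_eq_zero [IsProbabilityMeasure μ] {ℱ : Filtration ℕ m₀}
    {D : ℕ → Ω → ℝ} {B : ℝ}
    (hD : ∀ k, StronglyMeasurable[ℱ (k + 1)] (D k)) (hD2 : ∀ k, MemLp (D k) 2 μ)
    (hzero : ∀ k, μ[D k | ℱ k] =ᵐ[μ] 0)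
    (hB : ∀ n, ∑ k ∈ Finset.range n, ∫ ω, D k ω ^ 2 ∂μ ≤ B) :
    ∀ᵐ ω ∂μ, ∃ c, Tendsto (fun n => ∑ k ∈ Finset.range n, D k ω) atTop (nhds c) := by
  set M : ℕ → Ω → ℝ := fun n ω => ∑ k ∈ Finset.range n, D k ω with hM
  have hM2 : ∀ n, MemLp (M n) 2 μ := fun n => memLp_finsetSum _ fun k _ => hD2 k
  have hMm : StronglyAdapted ℱ M := fun n =>
    Finset.stronglyMeasurable_fun_sum _ fun k hk =>
      (hD k).mono (ℱ.mono (Finset.mem_range.1 hk))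
  have hsucc : ∀ n, M (n + 1) = fun ω => M n ω + D n ω := fun n => by
    ext ω; simp only [hM, Finset.sum_range_succ]
  have hmart : Martingale M ℱ μ := by
    refine martingale_of_condExp_sub_eq_zero_nat hMm
      (fun n => (hM2 n).integrable one_le_two) fun n => ?_
    have : M (n + 1) - M n = D n := by ext ω; simp [hsucc]
    rw [this]
    exact hzero n
  have horth : ∀ n, ∫ ω, M n ω * D n ω ∂μ = 0 := by
    intro n
    have hi : Integrable (M n * D n) μ := (hM2 n).integrable_mul (hD2 n)
    have h1 := condExp_mul_of_stronglyMeasurable_left (hMm n) hi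
      ((hD2 n).integrable one_le_two)
    have h2 : μ[M n * D n | ℱ n] =ᵐ[μ] 0 := by
      filter_upwards [h1, hzero n] with ω h1 h2
      simp [h1, h2]
    calc ∫ ω, M n ω * D n ω ∂μ = ∫ ω, (μ[M n * D n | ℱ n]) ω ∂μ :=
          (integral_condExp (ℱ.le n)).symm
      _ = 0 := by rw [integral_congr_ae h2]; simp
  have hvar : ∀ n, ∫ ω, M n ω ^ 2 ∂μ = ∑ k ∈ Finset.range n, ∫ ω, D k ω ^ 2 ∂μ := by
    intro n
    induction n with
    | zero => simp [hM]
    | succ n ih =>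
      have e : ∀ ω, M (n + 1) ω ^ 2 = M n ω ^ 2 + 2 * (M n ω * D n ω) + D n ω ^ 2 := fun ω => by
        rw [hsucc]; ring
      have hi : Integrable (fun ω => M n ω * D n ω) μ := (hM2 n).integrable_mul (hD2 n)
      have hi' : Integrable (fun ω => M n ω ^ 2 + 2 * (M n ω * D n ω)) μ :=
        (hM2 n).integrable_sq.add (hi.const_mul 2)
      simp_rw [e]
      rw [integral_add hi' (hD2 n).integrable_sq,
        integral_add (hM2 n).integrable_sq (hi.const_mul 2), integral_const_mul, horth, ih,
        Finset.sum_range_succ]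
      ring
  -- The bound in `L²` becomes one in `L¹` through `|M| ≤ 1 + M ^ 2`.
  refine hmart.submartingale.exists_ae_tendsto_of_bdd (R := (1 + B).toNNReal) fun n => ?_
  have hi := (hM2 n).integrable one_le_two
  rw [eLpNorm_one_eq_lintegral_enorm, ← ofReal_integral_norm_eq_lintegral_enorm hi]
  refine ENNReal.ofReal_le_ofReal ?_
  calc ∫ ω, ‖M n ω‖ ∂μ ≤ ∫ ω, (1 + M n ω ^ 2) ∂μ := by
        refine integral_mono hi.norm ((integrable_const _).add (hM2 n).integrable_sq) fun ω => ?_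
        simp only [Real.norm_eq_abs]
        nlinarith [sq_nonneg (|M n ω| - 1), sq_abs (M n ω), sq_nonneg (|M n ω|)]
    _ = 1 + ∑ k ∈ Finset.range n, ∫ ω, D k ω ^ 2 ∂μ := by
        rw [integral_add (integrable_const _) (hM2 n).integrable_sq, hvar]; simp
    _ ≤ 1 + B := by gcongr; exact hB n

end Probability

/-! ### AdaGrad-Norm adapted to a filtration -/

section AdaGrad

variable {Ω : Type*} {m₀ : MeasurableSpace Ω} {μ : Measure Ω}
  {E : Type*} [NormedAddCommGroup E] [InnerProductSpace ℝ E] [CompleteSpace E]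

/-- AdaGrad-Norm iterates `x` adapted to a filtration, with stochastic gradients `H` and
accumulated squared norms `T`: the step from `x k` to `x (k + 1)` uses `H k`. -/
structure IsAdaptedAdaGrad (μ : Measure Ω) (ℱ : Filtration ℕ m₀) (g : E → ℝ) (L : ℝ≥0)
    (α S₀ σ₀ σ₁ : ℝ) (x H : ℕ → Ω → E) (T : ℕ → Ω → ℝ) : Prop where
  differentiable : Differentiable ℝ g
  nonneg : ∀ y, 0 ≤ g y
  L_pos : 0 < L
  lipschitz : LipschitzWith L (∇ g)
  α_pos : 0 < α
  S₀_pos : 0 < S₀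
  σ₀_pos : 0 < σ₀
  σ₁_pos : 0 < σ₁
  x_meas : ∀ k, StronglyMeasurable[ℱ k] (x k)
  H_meas : ∀ k, StronglyMeasurable[ℱ (k + 1)] (H k)
  T_meas : ∀ k, StronglyMeasurable[ℱ k] (T k)
  le_T : ∀ k ω, S₀ ≤ T k ω
  T_succ : ∀ k ω, T (k + 1) ω = T k ω + ‖H k ω‖ ^ 2
  x_succ : ∀ k ω, x (k + 1) ω = x k ω - (α / √(T (k + 1) ω)) • H k ω
  memLp_H : ∀ k, MemLp (H k) 2 μ
  condExp_H : ∀ k, μ[H k | ℱ k] =ᵐ[μ] fun ω => ∇ g (x k ω)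
  condExp_H_sq : ∀ k, μ[fun ω => ‖H k ω‖ ^ 2 | ℱ k]
    ≤ᵐ[μ] fun ω => σ₀ * ‖∇ g (x k ω)‖ ^ 2 + σ₁

namespace IsAdaptedAdaGrad

variable {ℱ : Filtration ℕ m₀} {g : E → ℝ} {L : ℝ≥0} {α S₀ σ₀ σ₁ : ℝ} {x H : ℕ → Ω → E}
  {T : ℕ → Ω → ℝ}

theorem T_pos (h : IsAdaptedAdaGrad μ ℱ g L α S₀ σ₀ σ₁ x H T) (k : ℕ) (ω : Ω) : 0 < T k ω :=
  h.S₀_pos.trans_le (h.le_T k ω)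

theorem gradient_meas (h : IsAdaptedAdaGrad μ ℱ g L α S₀ σ₀ σ₁ x H T) (k : ℕ) :
    StronglyMeasurable[ℱ k] fun ω => ∇ g (x k ω) :=
  h.lipschitz.continuous.comp_stronglyMeasurable (h.x_meas k)

theorem memLp_gradient [IsProbabilityMeasure μ] (h : IsAdaptedAdaGrad μ ℱ g L α S₀ σ₀ σ₁ x H T)
    (k : ℕ) : MemLp (fun ω => ∇ g (x k ω)) 2 μ :=
  ((h.memLp_H k).condExp one_le_two).ae_eq (h.condExp_H k)

theorem integrable_sq_div [IsProbabilityMeasure μ] (h : IsAdaptedAdaGrad μ ℱ g L α S₀ σ₀ σ₁ x H T)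
    {Y : Ω → E} (hY : MemLp Y 2 μ) (k : ℕ) : Integrable (fun ω => ‖Y ω‖ ^ 2 / T k ω) μ := by
  have hY2 : Integrable (fun ω => ‖Y ω‖ ^ 2) μ := hY.norm.integrable_sq
  refine Integrable.mono' (hY2.div_const S₀) (hY2.1.div₀
    ((h.T_meas k).mono (ℱ.le k)).aestronglyMeasurable) (ae_of_all _ fun ω => ?_)
  rw [Real.norm_of_nonneg (div_nonneg (sq_nonneg _) (h.T_pos k ω).le)]
  have := h.S₀_pos
  have := h.le_T k ω
  gcongr

theorem norm_step (h : IsAdaptedAdaGrad μ ℱ g L α S₀ σ₀ σ₁ x H T) (k : ℕ) (ω : Ω) :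
    ‖x (k + 1) ω - x k ω‖ = α / √(T k ω + ‖H k ω‖ ^ 2) * ‖H k ω‖ := by
  rw [h.x_succ, sub_sub_cancel_left, norm_neg, norm_smul,
    Real.norm_of_nonneg (div_nonneg h.α_pos.le (Real.sqrt_nonneg _)), h.T_succ]

theorem norm_step_le (h : IsAdaptedAdaGrad μ ℱ g L α S₀ σ₀ σ₁ x H T) (k : ℕ) (ω : Ω) :
    ‖x (k + 1) ω - x k ω‖ ≤ α := by
  have hT := h.T_pos k ω
  have h1 : 0 < √(T k ω + ‖H k ω‖ ^ 2) := Real.sqrt_pos.2 (by positivity)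
  rw [h.norm_step, div_mul_eq_mul_div, div_le_iff₀ h1]
  exact mul_le_mul_of_nonneg_left (Real.le_sqrt_of_sq_le (by linarith)) h.α_pos.le

theorem descent (h : IsAdaptedAdaGrad μ ℱ g L α S₀ σ₀ σ₁ x H T) (k : ℕ) (ω : Ω) :
    g (x (k + 1) ω) ≤ g (x k ω)
      - α / √(T k ω + ‖H k ω‖ ^ 2) * inner ℝ (∇ g (x k ω)) (H k ω)
      + L * (α / √(T k ω + ‖H k ω‖ ^ 2) * ‖H k ω‖) ^ 2 := by
  have h1 := descent_of_lipschitzWith_gradient h.differentiable h.lipschitz (x k ω) (x (k + 1) ω)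
  rw [h.norm_step, h.x_succ, sub_sub_cancel_left, inner_neg_right, inner_smul_right,
    h.T_succ] at h1
  rw [h.x_succ, h.T_succ]
  linarith

theorem norm_gradient_succ_le (h : IsAdaptedAdaGrad μ ℱ g L α S₀ σ₀ σ₁ x H T) (k : ℕ) (ω : Ω) :
    ‖∇ g (x (k + 1) ω)‖ ≤
      ‖∇ g (x k ω)‖ + L * (α / √(T k ω + ‖H k ω‖ ^ 2) * ‖H k ω‖) := by
  have h1 := h.lipschitz.dist_le_mul (x (k + 1) ω) (x k ω)
  rw [dist_eq_norm, dist_eq_norm, h.norm_step] at h1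
  linarith [norm_le_norm_add_norm_sub' (∇ g (x (k + 1) ω)) (∇ g (x k ω))]

/-- If the objective is at most `K`, one step takes it to at most a constant. -/
theorem objective_succ_le (h : IsAdaptedAdaGrad μ ℱ g L α S₀ σ₀ σ₁ x H T) {k : ℕ} {ω : Ω} {K : ℝ}
    (hK : g (x k ω) ≤ K) : g (x (k + 1) ω) ≤ K + 2 * L * K + α ^ 2 / 2 + L * α ^ 2 := by
  have h1 := descent_of_lipschitzWith_gradient h.differentiable h.lipschitz (x k ω) (x (k + 1) ω)
  have h2 := norm_gradient_sq_le h.differentiable h.nonneg h.L_pos h.lipschitz (x k ω)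
  have h3 := real_inner_le_norm (∇ g (x k ω)) (x (k + 1) ω - x k ω)
  have h4 : ‖x (k + 1) ω - x k ω‖ ^ 2 ≤ α ^ 2 :=
    pow_le_pow_left₀ (norm_nonneg _) (h.norm_step_le k ω) 2
  have hL : (0 : ℝ) ≤ L := L.coe_nonneg
  have h5 := mul_le_mul_of_nonneg_left h4 hL
  have h6 : 4 * L * g (x k ω) ≤ 4 * L * K := by gcongr
  have h7 := sq_nonneg (‖∇ g (x k ω)‖ - ‖x (k + 1) ω - x k ω‖)
  linarith

/-- The inner product of the stochastic gradient with a predictable vector. -/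
theorem condExp_inner [IsProbabilityMeasure μ] (h : IsAdaptedAdaGrad μ ℱ g L α S₀ σ₀ σ₁ x H T)
    {k : ℕ} {Y : Ω → E} (hY : StronglyMeasurable[ℱ k] Y) (hY2 : MemLp Y 2 μ) :
    μ[fun ω => inner ℝ (Y ω) (H k ω) | ℱ k] =ᵐ[μ] fun ω => inner ℝ (Y ω) (∇ g (x k ω)) := by
  have h1 := condExp_bilin_of_stronglyMeasurable_left (innerSL ℝ) hY
    (integrable_inner_of_memLp_two hY2 (h.memLp_H k)) ((h.memLp_H k).integrable one_le_two)
  filter_upwards [h1, h.condExp_H k] with ω h1 h2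
  rw [h2] at h1
  exact h1

/-- The squared norm of the stochastic gradient with a bounded predictable weight. -/
theorem condExp_mul_norm_sq_le [IsProbabilityMeasure μ]
    (h : IsAdaptedAdaGrad μ ℱ g L α S₀ σ₀ σ₁ x H T)
    {k : ℕ} {c : Ω → ℝ} {C : ℝ} (hc : StronglyMeasurable[ℱ k] c) (hc0 : ∀ ω, 0 ≤ c ω)
    (hcC : ∀ ω, c ω ≤ C) :
    Integrable (fun ω => c ω * ‖H k ω‖ ^ 2) μ ∧ μ[fun ω => c ω * ‖H k ω‖ ^ 2 | ℱ k]
      ≤ᵐ[μ] fun ω => c ω * (σ₀ * ‖∇ g (x k ω)‖ ^ 2 + σ₁) := by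
  have hi : Integrable (fun ω => ‖H k ω‖ ^ 2) μ := (h.memLp_H k).norm.integrable_sq
  have hci : Integrable (fun ω => c ω * ‖H k ω‖ ^ 2) μ :=
    hi.bdd_mul (c := C) (hc.mono (ℱ.le k)).aestronglyMeasurable
      (ae_of_all _ fun ω => by rw [Real.norm_of_nonneg (hc0 ω)]; exact hcC ω)
  refine ⟨hci, ?_⟩
  have h1 := condExp_mul_of_stronglyMeasurable_left hc hci hi
  filter_upwards [h1, h.condExp_H_sq k] with ω h1 h2
  refine (le_of_eq h1).trans ?_
  exact mul_le_mul_of_nonneg_left h2 (hc0 ω)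

/-- The sum of the expectations of `‖∇ g (x k)‖ ^ 2 / T k` converges, once localized on an event
that belongs to the initial σ-algebra. -/
theorem exists_sum_setIntegral_gradient_sq_div_le [IsProbabilityMeasure μ]
    (h : IsAdaptedAdaGrad μ ℱ g L α S₀ σ₀ σ₁ x H T) :
    ∃ V : Ω → ℝ, Measurable[ℱ 0] V ∧ ∀ K, 0 ≤ K → ∀ n,
      ∑ k ∈ Finset.range n, ∫ ω in {ω | V ω ≤ K}, ‖∇ g (x k ω)‖ ^ 2 / T k ω ∂μ ≤ 4 / α * K := by
  have hα := h.α_pos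
  have hσ₀ := h.σ₀_pos
  have hσ₁ := h.σ₁_pos
  set w : ℕ → Ω → E := fun k ω => ∇ g (x k ω) with hw
  have hwm : ∀ k, StronglyMeasurable[ℱ k] (w k) := h.gradient_meas
  have hTm := h.T_meas
  set C₁ := α * σ₁ / 2 + α * σ₀ / 2 * (1 + 2 * σ₀) * (L * α) ^ 2 with hC
  have hC₁ : 0 ≤ C₁ := by positivity
  set V : ℕ → Ω → ℝ := fun k ω => g (x k ω) / √(T k ω)
    + (α * σ₀ / 2 * ‖w k ω‖ ^ 2 + C₁) / T k ω + 2 * L * α ^ 2 / √(T k ω) with hV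
  -- The denominator of this predictable weight cancels the conditional variance bound `σ₀ * ‖w k ω‖
  -- ^ 2 + σ₁`, and it also keeps the weight bounded.
  set c : ℕ → Ω → ℝ := fun k ω =>
    α * (‖w k ω‖ ^ 2 / (T k ω * (σ₀ * ‖w k ω‖ ^ 2 + σ₁))) / 2 with hc
  set N₁ : ℕ → Ω → ℝ := fun k ω => inner ℝ ((-(α / T k ω)) • w k ω) (H k ω) with hN₁
  set N₂ : ℕ → Ω → ℝ := fun k ω => c k ω * ‖H k ω‖ ^ 2 with hN₂
  set D : ℕ → Ω → ℝ := fun k ω => α / 4 * (‖w k ω‖ ^ 2 / T k ω) with hD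
  have hDi : ∀ k, Integrable (D k) μ := fun k =>
    (h.integrable_sq_div (h.memLp_gradient k) k).const_mul _
  have hDm : ∀ k, StronglyMeasurable[ℱ k] (D k) := fun k =>
    (((hwm k).norm.pow 2).div (hTm k)).const_mul _
  have hYm : ∀ k, StronglyMeasurable[ℱ k] fun ω => (-(α / T k ω)) • w k ω := fun k =>
    ((stronglyMeasurable_const.div (hTm k)).neg).smul (hwm k)
  have hY2 : ∀ k, MemLp (fun ω => (-(α / T k ω)) • w k ω) 2 μ := fun k => by
    refine MemLp.of_le_mul (c := α / S₀) (h.memLp_gradient k)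
      ((hYm k).mono (ℱ.le k)).aestronglyMeasurable (ae_of_all _ fun ω => ?_)
    rw [norm_smul, norm_neg, Real.norm_of_nonneg (div_nonneg hα.le (h.T_pos k ω).le)]
    have := h.S₀_pos
    have := h.le_T k ω
    gcongr
  have hN₁i : ∀ k, Integrable (N₁ k) μ := fun k => integrable_inner_of_memLp_two (hY2 k) (h.memLp_H k)
  have hcm : ∀ k, StronglyMeasurable[ℱ k] (c k) := fun k => by
    have hn : StronglyMeasurable[ℱ k] fun ω => ‖w k ω‖ ^ 2 := (hwm k).norm.pow 2
    exact ((hn.div ((hTm k).mul ((hn.const_mul σ₀).add stronglyMeasurable_const))).const_mul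
      α).div stronglyMeasurable_const
  have hc0 : ∀ k ω, 0 ≤ c k ω := fun k ω => by
    have := h.T_pos k ω
    simp only [hc]
    positivity
  have hcC : ∀ k ω, c k ω ≤ α * (1 / (S₀ * σ₀)) / 2 := fun k ω => by
    have := h.T_pos k ω
    have := h.S₀_pos
    have := h.le_T k ω
    simp only [hc]
    gcongr ?_ * ?_ / _
    rw [div_le_div_iff₀ (by positivity) (by positivity), one_mul]
    calc ‖w k ω‖ ^ 2 * (S₀ * σ₀) = S₀ * (σ₀ * ‖w k ω‖ ^ 2) := by ring
      _ ≤ T k ω * (σ₀ * ‖w k ω‖ ^ 2 + σ₁) := by gcongr; linarith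
  have hN₂c := fun k => h.condExp_mul_norm_sq_le (hcm k) (hc0 k) (hcC k)
  have hV0 : Measurable[ℱ 0] (V 0) := by
    have h1 : StronglyMeasurable[ℱ 0] fun ω => g (x 0 ω) :=
      h.differentiable.continuous.comp_stronglyMeasurable (h.x_meas 0)
    have h2 : StronglyMeasurable[ℱ 0] fun ω => √(T 0 ω) :=
      Real.continuous_sqrt.comp_stronglyMeasurable (hTm 0)
    exact (((h1.div h2).add (((((hwm 0).norm.pow 2).const_mul _).add
      stronglyMeasurable_const).div (hTm 0))).add (stronglyMeasurable_const.div h2)).measurable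
  refine ⟨V 0, hV0, fun K hK n => ?_⟩
  have key := sum_setIntegral_le_of_nonneg_of_condExp_le (μ := μ) (ℱ := ℱ) (V := V)
      (N := fun k => N₁ k + N₂ k + D k) (D := D) ?_ hV0 ?_ ?_ hDi ?_ hK n
  · simp only [hD, integral_const_mul, ← Finset.mul_sum, probReal_univ, mul_one] at key
    rw [div_mul_eq_mul_div, le_div_iff₀ hα]
    linarith
  · intro k ω
    have := h.T_pos k ω
    have := h.nonneg (x k ω)
    simp only [hV]
    positivity
  · intro k ω
    have h1 := adagrad_lyapunov_step (h.T_pos k ω) (norm_nonneg (w (k + 1) ω))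
      (abs_real_inner_le_norm (w k ω) (H k ω)) (h.nonneg (x k ω)) hα L.coe_nonneg hσ₀ hσ₁
      (h.descent k ω) (h.norm_gradient_succ_le k ω)
    simp only [hV, h.T_succ]
    refine h1.trans (le_of_eq ?_)
    have := h.T_pos k ω
    simp only [hN₁, hN₂, hD, hc, hC, Pi.add_apply, inner_smul_left, conj_trivial]
    ring
  · exact fun k => ((hN₁i k).add (hN₂c k).1).add (hDi k)
  · intro k
    have e1 := condExp_add ((hN₁i k).add (hN₂c k).1) (hDi k) (ℱ k)
    have e2 := condExp_add (hN₁i k) (hN₂c k).1 (ℱ k)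
    have e3 := condExp_of_stronglyMeasurable (ℱ.le k) (hDm k) (hDi k)
    filter_upwards [e1, e2, h.condExp_inner (hYm k) (hY2 k), (hN₂c k).2] with ω e1 e2 e4 e5
    have hT := h.T_pos k ω
    rw [e1, Pi.add_apply, e2, Pi.add_apply, e3]
    -- In units of `D`, the inner product contributes `-4`, the Young term at most `2` and the
    -- growth of the gradient `1`: the total is at most `-D`.
    have e6 : c k ω * (σ₀ * ‖∇ g (x k ω)‖ ^ 2 + σ₁) = 2 * D k ω := by
      simp only [hc, hD, hw]
      field_simp
      ring
    have e7 : inner ℝ ((-(α / T k ω)) • w k ω) (∇ g (x k ω)) = - (4 * D k ω) := by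
      rw [real_inner_smul_left, real_inner_self_eq_norm_sq]
      simp only [hD, hw]
      ring
    rw [e6] at e5
    rw [e7] at e4
    linarith

/-- Although `‖∇ g‖` is at most of order `√g`, the weaker linear growth suffices: it bounds the
gradient of `log (1 + g)`. -/
theorem norm_gradient_le (h : IsAdaptedAdaGrad μ ℱ g L α S₀ σ₀ σ₁ x H T) (y : E) :
    ‖∇ g y‖ ≤ (1 + L) * (1 + g y) := by
  have h0 := h.nonneg y
  have h1 := norm_gradient_sq_le h.differentiable h.nonneg h.L_pos h.lipschitz y
  have hL : (0 : ℝ) ≤ L := L.coe_nonneg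
  refine le_of_sq_le_sq ?_ (by positivity)
  calc ‖∇ g y‖ ^ 2 ≤ 4 * L * g y := h1
    _ ≤ (1 + L) ^ 2 * (1 + g y) ^ 2 := by
      gcongr
      · nlinarith [sq_nonneg ((L : ℝ) - 1)]
      · nlinarith
    _ = _ := by ring

/-- On an event where `∑ ‖∇ g (x k)‖ ^ 2 / T k` is integrable, the objective stays bounded, provided
that the gradient is bounded away from zero where the objective is large. -/
theorem ae_exists_forall_le_of_mem [IsProbabilityMeasure μ]
    (h : IsAdaptedAdaGrad μ ℱ g L α S₀ σ₀ σ₁ x H T) {η K : ℝ} (hη : 0 < η)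
    (hK : ∀ y, K < g y → η ≤ ‖∇ g y‖ ^ 2) {A : Set Ω} (hA : MeasurableSet[ℱ 0] A) {B : ℝ}
    (hB : ∀ n, ∑ k ∈ Finset.range n, ∫ ω in A, ‖∇ g (x k ω)‖ ^ 2 / T k ω ∂μ ≤ B) :
    ∀ᵐ ω ∂μ, ω ∈ A → ∃ M, ∀ k, g (x k ω) ≤ M := by
  have hα := h.α_pos
  have hσ₀ := h.σ₀_pos
  have hσ₁ := h.σ₁_pos
  have hS₀ := h.S₀_pos
  have hL : (0 : ℝ) ≤ L := L.coe_nonneg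
  set w : ℕ → Ω → E := fun k ω => ∇ g (x k ω) with hw
  have hwm : ∀ k, StronglyMeasurable[ℱ k] (w k) := h.gradient_meas
  -- A cutoff known at time `k`, hence compatible with conditioning. On it `σ₁ ≤ σ₁ / η * ‖w k ω‖ ^
  -- 2`, and by `hK` it contains every point of `A` with `K < g (x k ω)`.
  set s : ℕ → Set Ω := fun k => A ∩ {ω | η ≤ ‖w k ω‖ ^ 2} with hs
  have hsm : ∀ k, MeasurableSet[ℱ k] (s k) := fun k =>
    (ℱ.mono (Nat.zero_le k) _ hA).inter
      (((hwm k).norm.pow 2).measurable measurableSet_Ici)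
  set ρ : ℕ → Ω → ℝ := fun k => (s k).indicator 1 with hρ
  have hρm : ∀ k, StronglyMeasurable[ℱ k] (ρ k) := fun k =>
    stronglyMeasurable_one.indicator (hsm k)
  have hρ0 : ∀ k ω, 0 ≤ ρ k ω := fun k => Set.indicator_nonneg fun _ _ => zero_le_one
  have hρ1 : ∀ k ω, ρ k ω ≤ 1 := fun k => Set.indicator_le_self' fun _ _ => zero_le_one
  have hρsq : ∀ k ω, ρ k ω ^ 2 = ρ k ω := fun k ω => by
    by_cases hω : ω ∈ s k <;> simp [hρ, hω]
  set Q : ℕ → Ω → ℝ := fun k => A.indicator fun ω => ‖w k ω‖ ^ 2 / T k ω with hQ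
  have hAm : MeasurableSet A := ℱ.le 0 _ hA
  have hQi : ∀ k, Integrable (Q k) μ := fun k =>
    (h.integrable_sq_div (h.memLp_gradient k) k).indicator hAm
  have hQB : ∀ n, ∑ k ∈ Finset.range n, ∫ ω, Q k ω ∂μ ≤ B := fun n => by
    simp only [hQ, integral_indicator hAm]
    exact hB n
  have hρQ : ∀ k ω, ρ k ω / T k ω * ‖w k ω‖ ^ 2 ≤ Q k ω := fun k ω => by
    have hT := h.T_pos k ω
    by_cases hω : ω ∈ A
    · have : ρ k ω / T k ω * ‖w k ω‖ ^ 2 ≤ 1 / T k ω * ‖w k ω‖ ^ 2 := by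
        gcongr
        exact hρ1 k ω
      refine this.trans (le_of_eq ?_)
      simp only [hQ, Set.indicator_of_mem hω]
      ring
    · simp [hρ, hs, hQ, hω]
  -- the squared norms of the stochastic gradients
  set Z : ℕ → Ω → ℝ := fun k ω => ρ k ω / T k ω * ‖H k ω‖ ^ 2 with hZ
  have hZ0 : ∀ k ω, 0 ≤ Z k ω := fun k ω =>
    mul_nonneg (div_nonneg (hρ0 k ω) (h.T_pos k ω).le) (sq_nonneg _)
  have hZc := fun k => h.condExp_mul_norm_sq_le (k := k) (C := 1 / S₀)
    ((hρm k).div (h.T_meas k)) (fun ω => div_nonneg (hρ0 k ω) (h.T_pos k ω).le)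
    (fun ω => div_le_div₀ zero_le_one (hρ1 k ω) hS₀ (h.le_T k ω))
  have hZi : ∀ k, Integrable (Z k) μ := fun k => (hZc k).1
  have hZQ : ∀ k, ∫ ω, Z k ω ∂μ ≤ (σ₀ + σ₁ / η) * ∫ ω, Q k ω ∂μ := fun k => by
    rw [← integral_condExp (ℱ.le k), ← integral_const_mul]
    refine integral_mono_ae integrable_condExp ((hQi k).const_mul _) ?_
    filter_upwards [(hZc k).2] with ω hω
    refine hω.trans ?_
    have hT := h.T_pos k ω
    refine le_trans ?_ (mul_le_mul_of_nonneg_left (hρQ k ω) (by positivity))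
    by_cases hωs : ω ∈ s k
    · have h1 : η ≤ ‖w k ω‖ ^ 2 := hωs.2
      have h2 : σ₁ ≤ σ₁ / η * ‖w k ω‖ ^ 2 := by
        rw [div_mul_eq_mul_div, le_div_iff₀ hη]
        gcongr
      calc ρ k ω / T k ω * (σ₀ * ‖w k ω‖ ^ 2 + σ₁)
          ≤ ρ k ω / T k ω * (σ₀ * ‖w k ω‖ ^ 2 + σ₁ / η * ‖w k ω‖ ^ 2) :=
            mul_le_mul_of_nonneg_left (by linarith) (div_nonneg (hρ0 k ω) hT.le)
        _ = _ := by ring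
    · simp [hρ, hωs]
  have hZB : ∀ n, ∑ k ∈ Finset.range n, ∫ ω, Z k ω ∂μ ≤ (σ₀ + σ₁ / η) * B := fun n => by
    refine (Finset.sum_le_sum fun k _ => hZQ k).trans ?_
    rw [← Finset.mul_sum]
    exact mul_le_mul_of_nonneg_left (hQB n) (by positivity)
  -- the martingale
  set Y : ℕ → Ω → E := fun k ω => (-(α * ρ k ω / ((1 + g (x k ω)) * √(T k ω)))) • w k ω with hY
  have hYm : ∀ k, StronglyMeasurable[ℱ k] (Y k) := fun k => by
    have h1 : StronglyMeasurable[ℱ k] fun ω => g (x k ω) :=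
      h.differentiable.continuous.comp_stronglyMeasurable (h.x_meas k)
    have h2 : StronglyMeasurable[ℱ k] fun ω => √(T k ω) :=
      Real.continuous_sqrt.comp_stronglyMeasurable (h.T_meas k)
    exact (((hρm k).const_mul α).div ((stronglyMeasurable_const.add h1).mul h2)).neg.smul (hwm k)
  have hYle : ∀ k ω, ‖Y k ω‖ ≤ α * (1 + L) * (ρ k ω / √(T k ω)) := fun k ω => by
    have h1 := Real.sqrt_pos.2 (h.T_pos k ω)
    have h2 := h.nonneg (x k ω)
    have h3 := hρ0 k ω
    have h4 : ‖w k ω‖ ≤ (1 + L) * (1 + g (x k ω)) := h.norm_gradient_le (x k ω)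
    rw [hY, norm_smul, norm_neg, Real.norm_of_nonneg (by positivity)]
    calc α * ρ k ω / ((1 + g (x k ω)) * √(T k ω)) * ‖w k ω‖
        ≤ α * ρ k ω / ((1 + g (x k ω)) * √(T k ω)) * ((1 + L) * (1 + g (x k ω))) := by gcongr
      _ = _ := by field_simp
  have hYsq : ∀ k ω, ‖Y k ω‖ ^ 2 ≤ (α * (1 + L)) ^ 2 * (ρ k ω / T k ω) := fun k ω => by
    calc ‖Y k ω‖ ^ 2 ≤ (α * (1 + L) * (ρ k ω / √(T k ω))) ^ 2 := by gcongr; exact hYle k ω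
      _ = _ := by rw [mul_pow, div_pow, hρsq, Real.sq_sqrt (h.T_pos k ω).le]
  have hYC : ∀ k ω, ‖Y k ω‖ ≤ α * (1 + L) * (1 / √S₀) := fun k ω => by
    refine (hYle k ω).trans ?_
    have h1 := Real.sqrt_pos.2 hS₀
    gcongr
    · exact hρ1 k ω
    · exact h.le_T k ω
  have hY2 : ∀ k, MemLp (Y k) 2 μ := fun k =>
    MemLp.of_bound ((hYm k).mono (ℱ.le k)).aestronglyMeasurable _ (ae_of_all _ (hYC k))
  set D : ℕ → Ω → ℝ := fun k ω => inner ℝ (Y k ω) (H k ω - w k ω) with hD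
  have hDm : ∀ k, StronglyMeasurable[ℱ (k + 1)] (D k) := fun k =>
    ((hYm k).mono (ℱ.mono k.le_succ)).inner
      ((h.H_meas k).sub ((hwm k).mono (ℱ.mono k.le_succ)))
  have hHw : ∀ k, MemLp (fun ω => H k ω - w k ω) 2 μ := fun k =>
    (h.memLp_H k).sub (h.memLp_gradient k)
  have hD2 : ∀ k, MemLp (D k) 2 μ := fun k => by
    refine MemLp.of_le_mul (c := α * (1 + L) * (1 / √S₀)) (hHw k)
      ((hDm k).mono (ℱ.le _)).aestronglyMeasurable (ae_of_all _ fun ω => ?_)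
    refine (norm_inner_le_norm (𝕜 := ℝ) _ _).trans ?_
    gcongr
    exact hYC k ω
  have hDzero : ∀ k, μ[D k | ℱ k] =ᵐ[μ] 0 := fun k => by
    have hYw := integrable_inner_of_memLp_two (hY2 k) (h.memLp_gradient k)
    have e0 : D k = (fun ω => inner ℝ (Y k ω) (H k ω)) - fun ω => inner ℝ (Y k ω) (w k ω) := by
      ext ω
      simp only [hD, inner_sub_right, Pi.sub_apply]
    have e1 := condExp_sub (integrable_inner_of_memLp_two (hY2 k) (h.memLp_H k)) hYw (ℱ k)
    have e2 := condExp_of_stronglyMeasurable (ℱ.le k) ((hYm k).inner (𝕜 := ℝ) (hwm k)) hYw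
    rw [e0]
    filter_upwards [e1, h.condExp_inner (hYm k) (hY2 k)] with ω e1 e3
    rw [e1, Pi.sub_apply, e3, e2]
    simp [hw]
  have hDsq : ∀ k, ∫ ω, D k ω ^ 2 ∂μ ≤
      (α * (1 + L)) ^ 2 * 2 * (∫ ω, Z k ω ∂μ + ∫ ω, Q k ω ∂μ) := fun k => by
    rw [← integral_add (hZi k) (hQi k), ← integral_const_mul]
    refine integral_mono (hD2 k).integrable_sq (((hZi k).add (hQi k)).const_mul _) fun ω => ?_
    have hT := h.T_pos k ω
    have h3 := hρ0 k ω
    have h1 : ‖H k ω - w k ω‖ ^ 2 ≤ 2 * (‖H k ω‖ ^ 2 + ‖w k ω‖ ^ 2) := by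
      have := norm_sub_le (H k ω) (w k ω)
      calc ‖H k ω - w k ω‖ ^ 2 ≤ (‖H k ω‖ + ‖w k ω‖) ^ 2 := by gcongr
        _ ≤ _ := by linarith [sq_nonneg (‖H k ω‖ - ‖w k ω‖)]
    calc D k ω ^ 2 ≤ (‖Y k ω‖ * ‖H k ω - w k ω‖) ^ 2 :=
          sq_le_sq' (by linarith [(abs_le.1 (abs_real_inner_le_norm (Y k ω) (H k ω - w k ω))).1])
            (real_inner_le_norm _ _)
      _ = ‖Y k ω‖ ^ 2 * ‖H k ω - w k ω‖ ^ 2 := mul_pow _ _ _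
      _ ≤ (α * (1 + L)) ^ 2 * (ρ k ω / T k ω) * (2 * (‖H k ω‖ ^ 2 + ‖w k ω‖ ^ 2)) := by
          gcongr
          exact hYsq k ω
      _ = (α * (1 + L)) ^ 2 * 2 * (Z k ω + ρ k ω / T k ω * ‖w k ω‖ ^ 2) := by
          simp only [hZ]; ring
      _ ≤ (α * (1 + L)) ^ 2 * 2 * (Z k ω + Q k ω) := by
          gcongr
          exact hρQ k ω
  have hDB : ∀ n, ∑ k ∈ Finset.range n, ∫ ω, D k ω ^ 2 ∂μ ≤
      (α * (1 + L)) ^ 2 * 2 * ((σ₀ + σ₁ / η) * B + B) := fun n => by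
    refine (Finset.sum_le_sum fun k _ => hDsq k).trans ?_
    rw [← Finset.mul_sum, Finset.sum_add_distrib]
    exact mul_le_mul_of_nonneg_left (add_le_add (hZB n) (hQB n)) (by positivity)
  filter_upwards [ae_exists_tendsto_sum_of_condExp_eq_zero hDm hD2 hDzero hDB,
    ae_summable_of_sum_integral_le (fun k => ae_of_all _ (hZ0 k)) hZi hZB] with ω hω₁ hω₂ hωA
  obtain ⟨c, hc⟩ := hω₁
  have hlim := (hc.add (hω₂.hasSum.tendsto_sum_nat.const_mul
    (α * (1 + L) + L * α ^ 2))).norm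
  obtain ⟨b, hb⟩ := hlim.bddAbove_range
  have hP : ∀ k, K < g (x k ω) → Real.log (1 + g (x (k + 1) ω)) ≤
      Real.log (1 + g (x k ω)) + (D k ω + (α * (1 + L) + L * α ^ 2) * Z k ω) := by
    intro k hk
    have h1 := adagrad_log_step (h.T_pos k ω) (norm_nonneg _)
      (abs_real_inner_le_norm (w k ω) (H k ω)) (h.norm_gradient_le (x k ω)) (h.nonneg _)
      (h.nonneg (x (k + 1) ω)) hα hL (h.descent k ω)
    have h2 : ρ k ω = 1 := Set.indicator_of_mem (show ω ∈ s k from ⟨hωA, hK _ hk⟩) _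
    have h3 := Real.sqrt_pos.2 (h.T_pos k ω)
    have h4 := h.nonneg (x k ω)
    have h5 : D k ω = -(α * (inner ℝ (w k ω) (H k ω) / ((1 + g (x k ω)) * √(T k ω))))
        + α * (‖w k ω‖ ^ 2 / ((1 + g (x k ω)) * √(T k ω))) := by
      simp only [hD, hY, h2, real_inner_smul_left, inner_sub_right, real_inner_self_eq_norm_sq]
      ring
    -- Centring `H k` at its conditional mean adds this nonnegative term, which can only weaken the
    -- upper bound.
    have h6 : 0 ≤ α * (‖w k ω‖ ^ 2 / ((1 + g (x k ω)) * √(T k ω))) := by positivity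
    have h7 : Z k ω = ‖H k ω‖ ^ 2 / T k ω := by simp only [hZ, h2]; ring
    rw [h5, h7]
    linarith
  have hnP : ∀ k, ¬ K < g (x k ω) → Real.log (1 + g (x (k + 1) ω)) ≤
      Real.log (1 + (K + 2 * L * K + α ^ 2 / 2 + L * α ^ 2)) := by
    intro k hk
    have h1 := h.nonneg (x (k + 1) ω)
    have h2 := h.objective_succ_le (not_lt.1 hk)
    exact Real.log_le_log (by positivity) (by linarith)
  obtain ⟨M, hM⟩ := exists_forall_le_of_excursions (f := fun k => Real.log (1 + g (x k ω)))
    (u := fun k => D k ω + (α * (1 + L) + L * α ^ 2) * Z k ω) (P := fun k => K < g (x k ω))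
    (c := Real.log (1 + (K + 2 * L * K + α ^ 2 / 2 + L * α ^ 2))) (B := b)
    (fun n => by
      rw [Finset.sum_add_distrib, ← Finset.mul_sum]
      exact hb ⟨n, rfl⟩)
    hP hnP
  refine ⟨Real.exp M, fun k => ?_⟩
  have h1 := h.nonneg (x k ω)
  have h2 := (Real.log_le_iff_le_exp (by positivity)).1 (hM k)
  linarith

/-- The objective stays bounded along AdaGrad-Norm, provided that the gradient is bounded away from
zero where the objective is large. -/
theorem ae_exists_forall_le [IsProbabilityMeasure μ]
    (h : IsAdaptedAdaGrad μ ℱ g L α S₀ σ₀ σ₁ x H T) {η K : ℝ} (hη : 0 < η)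
    (hK : ∀ y, K < g y → η ≤ ‖∇ g y‖ ^ 2) : ∀ᵐ ω ∂μ, ∃ M, ∀ k, g (x k ω) ≤ M := by
  obtain ⟨V, hV, hVsum⟩ := h.exists_sum_setIntegral_gradient_sq_div_le
  have h1 : ∀ N : ℕ, ∀ᵐ ω ∂μ, ω ∈ {ω | V ω ≤ N} → ∃ M, ∀ k, g (x k ω) ≤ M := fun N =>
    h.ae_exists_forall_le_of_mem hη hK (hV measurableSet_Iic) (hVsum N N.cast_nonneg)
  filter_upwards [ae_all_iff.2 h1] with ω hω
  obtain ⟨N, hN⟩ := exists_nat_ge (V ω)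
  exact hω N hN

end IsAdaptedAdaGrad
end AdaGrad

/-! ### Histories of the noise and reduction to the adapted setting -/

section History

variable {Ω Ξ : Type*} {d : ℕ} {θ₁ : Ω → EuclideanSpace ℝ (Fin d)} {ξ : ℕ → Ω → Ξ}
  {G : EuclideanSpace ℝ (Fin d) → Ξ → EuclideanSpace ℝ (Fin d)} {α₀ S₀ : ℝ}
  {θ : ℕ → Ω → EuclideanSpace ℝ (Fin d)} {S : ℕ → Ω → ℝ}

theorem IsAdaGradNorm.le_S (h : IsAdaGradNorm G ξ α₀ S₀ θ S) (n : ℕ) (ω : Ω) : S₀ ≤ S n ω := by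
  induction n with
  | zero => exact (h.S_zero ω).ge
  | succ n ih => rw [h.S_succ]; linarith [sq_nonneg ‖G (θ (n + 1) ω) (ξ (n + 1) ω)‖]

variable [MeasurableSpace Ξ]

theorem historySigmaAlgebra_mono : Monotone (historySigmaAlgebra θ₁ ξ) := by
  refine monotone_nat_of_le_succ fun n => ?_
  cases n with
  | zero => exact bot_le
  | succ n =>
    exact sup_le_sup_left (biSup_mono fun i hi => ⟨hi.1, hi.2.trans n.succ.le_succ⟩) _

theorem measurable_initial_history (n : ℕ) : Measurable[historySigmaAlgebra θ₁ ξ (n + 1)] θ₁ :=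
  Measurable.of_comap_le le_sup_left

theorem measurable_noise_history (n : ℕ) :
    Measurable[historySigmaAlgebra θ₁ ξ (n + 1)] (ξ (n + 1)) :=
  Measurable.of_comap_le (le_sup_of_le_right
    (le_iSup₂_of_le (n + 1) ⟨Nat.le_add_left 1 n, le_rfl⟩ le_rfl))

theorem measurable_oracle_history
    (hG : Measurable (fun p : EuclideanSpace ℝ (Fin d) × Ξ => G p.1 p.2)) {n : ℕ}
    (hθ : Measurable[historySigmaAlgebra (θ 1) ξ (n + 1)] (θ (n + 1))) :
    Measurable[historySigmaAlgebra (θ 1) ξ (n + 1)]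
      fun ω => G (θ (n + 1) ω) (ξ (n + 1) ω) :=
  hG.comp (hθ.prodMk (measurable_noise_history n))

theorem IsAdaGradNorm.measurable_iterate_succ (h : IsAdaGradNorm G ξ α₀ S₀ θ S)
    (hG : Measurable (fun p : EuclideanSpace ℝ (Fin d) × Ξ => G p.1 p.2)) {n : ℕ}
    (hθ : Measurable[historySigmaAlgebra (θ 1) ξ (n + 1)] (θ (n + 1)))
    (hS : Measurable[historySigmaAlgebra (θ 1) ξ (n + 1)] (S (n + 1))) :
    Measurable[historySigmaAlgebra (θ 1) ξ (n + 1)] (θ (n + 2)) := by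
  have e : θ (n + 2) = fun ω => θ (n + 1) ω -
      (α₀ / √(S (n + 1) ω)) • G (θ (n + 1) ω) (ξ (n + 1) ω) := funext (h.θ_succ n)
  rw [e]
  exact hθ.sub ((hS.sqrt.const_div α₀).smul (measurable_oracle_history hG hθ))

theorem IsAdaGradNorm.measurable_history (h : IsAdaGradNorm G ξ α₀ S₀ θ S)
    (hG : Measurable (fun p : EuclideanSpace ℝ (Fin d) × Ξ => G p.1 p.2)) (n : ℕ) :
    Measurable[historySigmaAlgebra (θ 1) ξ (n + 1)] (θ (n + 1)) ∧
      Measurable[historySigmaAlgebra (θ 1) ξ (n + 1)] (S (n + 1)) := by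
  have hadd : Measurable fun p : ℝ × EuclideanSpace ℝ (Fin d) => p.1 + ‖p.2‖ ^ 2 := by fun_prop
  induction n with
  | zero =>
    have hθ := measurable_initial_history (θ₁ := θ 1) (ξ := ξ) 0
    refine ⟨hθ, ?_⟩
    have e : S (0 + 1) = fun ω => S₀ + ‖G (θ (0 + 1) ω) (ξ (0 + 1) ω)‖ ^ 2 := by
      ext ω; rw [h.S_succ, h.S_zero]
    rw [e]
    exact hadd.comp (measurable_const.prodMk (measurable_oracle_history hG hθ))
  | succ n ih =>
    have hle : historySigmaAlgebra (θ 1) ξ (n + 1) ≤ historySigmaAlgebra (θ 1) ξ (n + 2) :=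
      historySigmaAlgebra_mono n.succ.le_succ
    have hS := ih.2.mono hle le_rfl
    have hθ := (h.measurable_iterate_succ hG ih.1 ih.2).mono hle le_rfl
    refine ⟨hθ, ?_⟩
    have e : S (n + 2) = fun ω => S (n + 1) ω + ‖G (θ (n + 2) ω) (ξ (n + 2) ω)‖ ^ 2 :=
      funext (h.S_succ (n + 1))
    rw [e]
    exact hadd.comp (hS.prodMk (measurable_oracle_history hG hθ))

variable [MeasurableSpace Ω]

theorem historySigmaAlgebra_le (hθ₁ : Measurable θ₁) (hξ : ∀ n ≥ 1, Measurable (ξ n)) (n : ℕ) :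
    historySigmaAlgebra θ₁ ξ n ≤ ‹MeasurableSpace Ω› := by
  cases n with
  | zero => exact bot_le
  | succ n =>
    exact sup_le hθ₁.comap_le (iSup₂_le fun i hi => (hξ i hi.1).comap_le)

/-- The filtration of the histories, starting with `σ(θ₁, ξ₁)`. -/
def historyFiltration (hθ₁ : Measurable θ₁) (hξ : ∀ n ≥ 1, Measurable (ξ n)) :
    Filtration ℕ ‹MeasurableSpace Ω› where
  seq n := historySigmaAlgebra θ₁ ξ (n + 1)
  mono' _ _ h := historySigmaAlgebra_mono (Nat.succ_le_succ h)
  le' n := historySigmaAlgebra_le hθ₁ hξ (n + 1)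

/-- Since `g` is bounded on bounded sets and not asymptotically flat, its gradient is bounded away
from zero where `g` is large. -/
theorem ObjectiveAssumptions.exists_le_norm_gradient_sq {g : EuclideanSpace ℝ (Fin d) → ℝ}
    (hg : ObjectiveAssumptions g) : ∃ η K : ℝ, 0 < η ∧ ∀ y, K < g y → η ≤ ‖∇ g y‖ ^ 2 := by
  obtain ⟨η, hη, hlim⟩ := hg.not_asymptotically_flat
  have hev := eventually_lt_of_lt_liminf hlim
  obtain ⟨r, -, hr⟩ := (Metric.hasBasis_cobounded_compl_closedBall
    (0 : EuclideanSpace ℝ (Fin d))).eventually_iff.1 hev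
  obtain ⟨K, hK⟩ := (isCompact_closedBall (0 : EuclideanSpace ℝ (Fin d)) r).bddAbove_image
    hg.contDiff.continuous.continuousOn
  refine ⟨η, K, hη, fun y hy => ?_⟩
  have hmem : y ∈ (Metric.closedBall (0 : EuclideanSpace ℝ (Fin d)) r)ᶜ := fun hy' =>
    hy.not_ge (hK (Set.mem_image_of_mem g hy'))
  exact (EReal.coe_lt_coe_iff.1 (hr hmem)).le

theorem IsCoerciveFunction.exists_norm_le {g : EuclideanSpace ℝ (Fin d) → ℝ}
    (hg : IsCoerciveFunction g) (M : ℝ) : ∃ r, ∀ y, g y ≤ M → ‖y‖ ≤ r := by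
  obtain ⟨r, -, hr⟩ := (Metric.hasBasis_cobounded_compl_closedBall
    (0 : EuclideanSpace ℝ (Fin d))).eventually_iff.1 (hg.eventually_gt_atTop M)
  refine ⟨r, fun y hy => ?_⟩
  by_contra hcon
  have hmem : y ∈ (Metric.closedBall (0 : EuclideanSpace ℝ (Fin d)) r)ᶜ := by
    simpa using hcon
  exact hy.not_gt (hr hmem)

/-- The indices start at `θ 2` because `ℱ₀` is trivial and need not make `θ 1` measurable, whereas
`θ (k + 2)` and `S (k + 1)` are known from `θ 1, ξ 1, …, ξ (k + 1)`. -/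
theorem IsAdaGradNorm.exists_isAdaptedAdaGrad {μ : Measure Ω} [IsProbabilityMeasure μ]
    {g : EuclideanSpace ℝ (Fin d) → ℝ} (h : IsAdaGradNorm G ξ α₀ S₀ θ S)
    (hG : Measurable (fun p : EuclideanSpace ℝ (Fin d) × Ξ => G p.1 p.2))
    (hξ : ∀ n ≥ 1, Measurable (ξ n)) (hα₀ : 0 < α₀) (hS₀ : 0 < S₀) (hθ₁ : Measurable (θ 1))
    (hg : ObjectiveAssumptions g) (hnoise : OracleAssumptions μ g G ξ θ) :
    ∃ (L : ℝ≥0) (σ₀ σ₁ : ℝ), IsAdaptedAdaGrad μ (historyFiltration hθ₁ hξ) g L α₀ S₀ σ₀ σ₁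
      (fun k => θ (k + 2)) (fun k ω => G (θ (k + 2) ω) (ξ (k + 2) ω)) (fun k => S (k + 1)) := by
  obtain ⟨L, hL⟩ := hg.lipschitz_gradient
  obtain ⟨σ₀, σ₁, hσ₀, hσ₁, hvar⟩ := hnoise.affine_variance
  have hmeas := h.measurable_history hG
  -- Enlarging the constants makes them positive, as the divisions by them require.
  refine ⟨L + 1, σ₀ + 1, σ₁ + 1, ?_⟩
  exact
    { differentiable := hg.contDiff.differentiable one_ne_zero
      nonneg := hg.nonneg
      L_pos := by positivity
      lipschitz := hL.weaken le_self_add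
      α_pos := hα₀
      S₀_pos := hS₀
      σ₀_pos := by linarith
      σ₁_pos := by linarith
      x_meas := fun k => (h.measurable_iterate_succ hG (hmeas k).1 (hmeas k).2).stronglyMeasurable
      H_meas := fun k => (measurable_oracle_history hG (hmeas (k + 1)).1).stronglyMeasurable
      T_meas := fun k => (hmeas k).2.stronglyMeasurable
      le_T := fun k => h.le_S (k + 1)
      T_succ := fun k => h.S_succ (k + 1)
      x_succ := fun k => h.θ_succ (k + 1)
      memLp_H := fun k => hnoise.memLp_two (k + 2) (by lia)
      condExp_H := fun k => hnoise.unbiased (k + 2) (by lia)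
      condExp_H_sq := fun k => by
        filter_upwards [hvar (k + 2) (by lia)] with ω hω
        refine hω.trans ?_
        nlinarith [sq_nonneg ‖∇ g (θ (k + 2) ω)‖] }

end History

theorem corollary3p1 {Ω Ξ : Type*} [MeasurableSpace Ω] [MeasurableSpace Ξ]
    (μ : Measure Ω) [IsProbabilityMeasure μ] {d : ℕ}
    (g : EuclideanSpace ℝ (Fin d) → ℝ)
    (G : EuclideanSpace ℝ (Fin d) → Ξ → EuclideanSpace ℝ (Fin d))
    (hG : Measurable (fun p : EuclideanSpace ℝ (Fin d) × Ξ => G p.1 p.2))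
    (ξ : ℕ → Ω → Ξ) (hξ : ∀ n ≥ 1, Measurable (ξ n))
    (hξ_indep : iIndepFun (fun n => ξ (n + 1)) μ)
    (α₀ S₀ : ℝ) (hα₀ : 0 < α₀) (hS₀ : 0 < S₀)
    (θ : ℕ → Ω → EuclideanSpace ℝ (Fin d)) (S : ℕ → Ω → ℝ)
    (hθ₁ : Measurable (θ 1))
    (hθS : IsAdaGradNorm G ξ α₀ S₀ θ S)
    (hg : ObjectiveAssumptions g)
    (hnoise : OracleAssumptions μ g G ξ θ)
    (hcoercive : IsCoerciveFunction g) :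
    ∀ᵐ ω ∂μ, (⨆ n ≥ 1, ‖θ n ω‖ₑ) < ∞ := by
  obtain ⟨L, σ₀, σ₁, h⟩ := hθS.exists_isAdaptedAdaGrad hG hξ hα₀ hS₀ hθ₁ hg hnoise
  obtain ⟨η, K, hη, hK⟩ := hg.exists_le_norm_gradient_sq
  filter_upwards [h.ae_exists_forall_le hη hK] with ω hω
  obtain ⟨M, hM⟩ := hω
  obtain ⟨r, hr⟩ := hcoercive.exists_norm_le M
  -- `θ 1` precedes the shifted sequence and enters the bound separately.
  have hle : ∀ n ≥ 1, ‖θ n ω‖ₑ ≤ ENNReal.ofReal (max ‖θ 1 ω‖ r) := by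
    intro n hn
    rw [← ofReal_norm]
    refine ENNReal.ofReal_le_ofReal ?_
    match n, hn with
    | 1, _ => exact le_max_left _ _
    | k + 2, _ => exact (hr _ (hM k)).trans (le_max_right _ _)
  exact (iSup₂_le hle).trans_lt ENNReal.ofReal_lt_top
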